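/- Let $(M,J,g)$ be a Hermitian manifold ($J$ an integrable complex structure, $g$ a Riemannian metric with $g(J\cdot,J\cdot)=g$; everything is smooth), with fundamental form $\omega(\cdot,\cdot)=g(J\cdot,\cdot)$, and let $\nabla$ be the Levi-Civita connection of $g$. Suppose that $(M,J,g)$ is locally conformally Kähler with Lee form $\theta$, i.e. $\theta$ is a $1$-form with $d\theta=0$ and $d\omega=\theta\wedge\omega$. Let $T=\theta^\sharp$ be the Lee vector field (the $g$-dual of $\theta$), let $F=\nabla T$ be the endomorphism field $X\mapsto\nabla_XT$ of $TM$, and let $J$ act on $1$-forms by $J\alpha=-\alpha\circ J$ (equivalently $(J\alpha)^\sharp=J(\alpha^\sharp)$). If $T$ is holomorphic, i.e. $\mathcal L_TJ=0$, then $$ \begin{aligned} dJd|\theta|^2={}&4\,\omega(F^2\cdot,\cdot)+2\,\omega((\mathcal L_TF)\cdot,\cdot)-T(|\theta|^2)\,\omega-2|\theta|^2\,\omega(F\cdot,\cdot)\\ &+d|\theta|^2\wedge J\theta+\theta\wedge Jd|\theta|^2 , \end{aligned} $$ where $(\alpha\wedge\beta)(X,Y)=\alpha(X)\beta(Y)-\alpha(Y)\beta(X)$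 for $1$-forms $\alpha,\beta$. -/

import Mathlib

open Bundle VectorField
open scoped Manifold ContDiff

noncomputable section

namespace LCK

section Basic

variable {E : Type*} [NormedAddCommGroup E] [NormedSpace ℝ E]
  {M : Type*} [TopologicalSpace M] [ChartedSpace E M]

/-- `X` is a smooth (`C^∞`) vector field. -/
def IsSmoothVF [IsManifold 𝓘(ℝ, E) ∞ M] (X : Π x : M, TangentSpace 𝓘(ℝ, E) x) : Prop :=
  ContMDiff 𝓘(ℝ, E) 𝓘(ℝ, E).tangent ∞ (fun x ↦ (⟨x, X x⟩ : TangentBundle 𝓘(ℝ, E) M))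

/-- `α` is a smooth `1`-form, i.e. a smooth section of the cotangent bundle. -/
def IsSmoothOneForm [IsManifold 𝓘(ℝ, E) ∞ M]
    (α : Π x : M, TangentSpace 𝓘(ℝ, E) x →L[ℝ] ℝ) : Prop :=
  ContMDiff 𝓘(ℝ, E) (𝓘(ℝ, E).prod 𝓘(ℝ, E →L[ℝ] ℝ)) ∞
    (fun x ↦ TotalSpace.mk' (E →L[ℝ] ℝ)
      (E := fun x : M ↦ TangentSpace 𝓘(ℝ, E) x →L[ℝ] ℝ) x (α x))

/-- `A` is a smooth field of endomorphisms of the tangent bundle. -/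
def IsSmoothEnd [IsManifold 𝓘(ℝ, E) ∞ M]
    (A : Π x : M, TangentSpace 𝓘(ℝ, E) x →L[ℝ] TangentSpace 𝓘(ℝ, E) x) : Prop :=
  ContMDiff 𝓘(ℝ, E) (𝓘(ℝ, E).prod 𝓘(ℝ, E →L[ℝ] E)) ∞
    (fun x ↦ TotalSpace.mk' (E →L[ℝ] E)
      (E := fun x : M ↦ TangentSpace 𝓘(ℝ, E) x →L[ℝ] TangentSpace 𝓘(ℝ, E) x) x (A x))

/-- The differential `df` of a real function, a `1`-form. -/
def dZero (f : M → ℝ) (x : M) : TangentSpace 𝓘(ℝ, E) x →L[ℝ] ℝ :=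
  mvfderiv 𝓘(ℝ, E) f x

/-- The derivative `X(f)` of a real function along a vector field. -/
def dirDeriv (X : Π x : M, TangentSpace 𝓘(ℝ, E) x) (f : M → ℝ) (x : M) : ℝ :=
  dZero f x (X x)

/-- The exterior derivative of a `1`-form, evaluated on vector fields:
`dα(X, Y) = X(α(Y)) - Y(α(X)) - α([X, Y])`. -/
def dOne (α : Π x : M, TangentSpace 𝓘(ℝ, E) x →L[ℝ] ℝ)
    (X Y : Π x : M, TangentSpace 𝓘(ℝ, E) x) (x : M) : ℝ :=
  dirDeriv X (fun y ↦ α y (Y y)) x - dirDeriv Y (fun y ↦ α y (X y)) x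
    - α x (mlieBracket 𝓘(ℝ, E) X Y x)

/-- The exterior derivative of a `2`-form, evaluated on vector fields:
`dη(X, Y, Z) = X(η(Y, Z)) + Y(η(Z, X)) + Z(η(X, Y)) - η([X, Y], Z) - η([Y, Z], X) - η([Z, X], Y)`.
-/
def dTwo (η : Π x : M, TangentSpace 𝓘(ℝ, E) x → TangentSpace 𝓘(ℝ, E) x → ℝ)
    (X Y Z : Π x : M, TangentSpace 𝓘(ℝ, E) x) (x : M) : ℝ :=
  dirDeriv X (fun y ↦ η y (Y y) (Z y)) x + dirDeriv Y (fun y ↦ η y (Z y) (X y)) x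
    + dirDeriv Z (fun y ↦ η y (X y) (Y y)) x
    - η x (mlieBracket 𝓘(ℝ, E) X Y x) (Z x) - η x (mlieBracket 𝓘(ℝ, E) Y Z x) (X x)
    - η x (mlieBracket 𝓘(ℝ, E) Z X x) (Y x)

/-- The wedge product of two `1`-forms: `(α ∧ β)(u, v) = α(u) β(v) - α(v) β(u)`. -/
def wedgeOneOne (α β : Π x : M, TangentSpace 𝓘(ℝ, E) x →L[ℝ] ℝ) (x : M)
    (u v : TangentSpace 𝓘(ℝ, E) x) : ℝ :=
  α x u * β x v - α x v * β x u

/-- The wedge product of a `1`-form with a `2`-form: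
`(α ∧ η)(u, v, w) = α(u) η(v, w) + α(v) η(w, u) + α(w) η(u, v)`. -/
def wedgeOneTwo (α : Π x : M, TangentSpace 𝓘(ℝ, E) x →L[ℝ] ℝ)
    (η : Π x : M, TangentSpace 𝓘(ℝ, E) x → TangentSpace 𝓘(ℝ, E) x → ℝ) (x : M)
    (u v w : TangentSpace 𝓘(ℝ, E) x) : ℝ :=
  α x u * η x v w + α x v * η x w u + α x w * η x u v

/-- The Lie derivative of an endomorphism field along `T`, evaluated on a vector field:
`(L_T A)(X) = [T, A X] - A [T, X]`. -/
def lieDerivEnd (T : Π x : M, TangentSpace 𝓘(ℝ, E) x)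
    (A : Π x : M, TangentSpace 𝓘(ℝ, E) x →L[ℝ] TangentSpace 𝓘(ℝ, E) x)
    (X : Π x : M, TangentSpace 𝓘(ℝ, E) x) (x : M) : TangentSpace 𝓘(ℝ, E) x :=
  mlieBracket 𝓘(ℝ, E) T (fun y ↦ A y (X y)) x - A x (mlieBracket 𝓘(ℝ, E) T X x)

/-- The Nijenhuis tensor of `J`, evaluated on vector fields:
`N(X, Y) = [J X, J Y] - J [J X, Y] - J [X, J Y] - [X, Y]`. -/
def nijenhuis (J : Π x : M, TangentSpace 𝓘(ℝ, E) x →L[ℝ] TangentSpace 𝓘(ℝ, E) x)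
    (X Y : Π x : M, TangentSpace 𝓘(ℝ, E) x) (x : M) : TangentSpace 𝓘(ℝ, E) x :=
  mlieBracket 𝓘(ℝ, E) (fun y ↦ J y (X y)) (fun y ↦ J y (Y y)) x
    - J x (mlieBracket 𝓘(ℝ, E) (fun y ↦ J y (X y)) Y x)
    - J x (mlieBracket 𝓘(ℝ, E) X (fun y ↦ J y (Y y)) x)
    - mlieBracket 𝓘(ℝ, E) X Y x

/-- `J` is a complex structure: a smooth almost complex structure which is integrable, i.e. whose
Nijenhuis tensor vanishes. -/
structure IsComplexStructure [IsManifold 𝓘(ℝ, E) ∞ M]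
    (J : Π x : M, TangentSpace 𝓘(ℝ, E) x →L[ℝ] TangentSpace 𝓘(ℝ, E) x) : Prop where
  smooth : IsSmoothEnd J
  sq : ∀ x u, J x (J x u) = -u
  integrable : ∀ X Y : Π x : M, TangentSpace 𝓘(ℝ, E) x, IsSmoothVF X → IsSmoothVF Y →
    ∀ x, nijenhuis J X Y x = 0

/-- The real vector field `T` is holomorphic: `L_T J = 0`. -/
def IsHolomorphicVF [IsManifold 𝓘(ℝ, E) ∞ M]
    (J : Π x : M, TangentSpace 𝓘(ℝ, E) x →L[ℝ] TangentSpace 𝓘(ℝ, E) x)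
    (T : Π x : M, TangentSpace 𝓘(ℝ, E) x) : Prop :=
  IsSmoothVF T ∧ ∀ X : Π x : M, TangentSpace 𝓘(ℝ, E) x, IsSmoothVF X →
    ∀ x, lieDerivEnd T J X x = 0

/-- The action of `J` on `1`-forms, `(J α)(u) = -α(J u)`. With respect to any Hermitian metric this
is the action of `J` on vectors transported by the musical isomorphism: `(J α)♯ = J (α♯)`. -/
def JForm (J : Π x : M, TangentSpace 𝓘(ℝ, E) x →L[ℝ] TangentSpace 𝓘(ℝ, E) x)
    (α : Π x : M, TangentSpace 𝓘(ℝ, E) x →L[ℝ] ℝ) (x : M) : TangentSpace 𝓘(ℝ, E) x →L[ℝ] ℝ :=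
  -(α x ∘L J x)

end Basic

section Metric

variable {E : Type*} [NormedAddCommGroup E] [NormedSpace ℝ E] [FiniteDimensional ℝ E]
  {M : Type*} [TopologicalSpace M] [ChartedSpace E M] [IsManifold 𝓘(ℝ, E) ∞ M]
  [RiemannianBundle (fun x : M ↦ TangentSpace 𝓘(ℝ, E) x)]

instance finiteDimensional_tangentSpace (x : M) :
    FiniteDimensional ℝ (TangentSpace 𝓘(ℝ, E) x) :=
  inferInstanceAs (FiniteDimensional ℝ E)

instance completeSpace_tangentSpace (x : M) : CompleteSpace (TangentSpace 𝓘(ℝ, E) x) :=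
  FiniteDimensional.complete ℝ _

/-- The vector field `α♯` which is dual to the `1`-form `α` with respect to the metric. -/
def sharp (α : Π x : M, TangentSpace 𝓘(ℝ, E) x →L[ℝ] ℝ) (x : M) : TangentSpace 𝓘(ℝ, E) x :=
  (InnerProductSpace.toDual ℝ (TangentSpace 𝓘(ℝ, E) x)).symm (α x)

/-- The function `|α|²`, for the norm on covectors which is dual to the metric. -/
def normSq (α : Π x : M, TangentSpace 𝓘(ℝ, E) x →L[ℝ] ℝ) (x : M) : ℝ :=
  ‖α x‖ ^ 2

/-- The fundamental form `ω(u, v) = g(J u, v)`. -/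
def fundForm (J : Π x : M, TangentSpace 𝓘(ℝ, E) x →L[ℝ] TangentSpace 𝓘(ℝ, E) x) (x : M)
    (u v : TangentSpace 𝓘(ℝ, E) x) : ℝ :=
  inner ℝ (J x u) v

/-- `(M, J, g)` is a Hermitian manifold. -/
structure IsHermitian (J : Π x : M, TangentSpace 𝓘(ℝ, E) x →L[ℝ] TangentSpace 𝓘(ℝ, E) x) :
    Prop where
  complex : IsComplexStructure J
  inner_map_map : ∀ (x : M) (u v : TangentSpace 𝓘(ℝ, E) x),
    inner ℝ (J x u) (J x v) = inner ℝ u v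

/-- `(M, J, g)` is locally conformally Kähler with Lee form `θ`: the manifold is Hermitian, `θ` is
closed and `dω = θ ∧ ω`. -/
structure IsLCK (J : Π x : M, TangentSpace 𝓘(ℝ, E) x →L[ℝ] TangentSpace 𝓘(ℝ, E) x)
    (θ : Π x : M, TangentSpace 𝓘(ℝ, E) x →L[ℝ] ℝ) : Prop where
  hermitian : IsHermitian J
  smooth : IsSmoothOneForm θ
  closed : ∀ X Y : Π x : M, TangentSpace 𝓘(ℝ, E) x, IsSmoothVF X → IsSmoothVF Y →
    ∀ x, dOne θ X Y x = 0
  d_fundForm : ∀ X Y Z : Π x : M, TangentSpace 𝓘(ℝ, E) x,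
    IsSmoothVF X → IsSmoothVF Y → IsSmoothVF Z →
    ∀ x, dTwo (fundForm J) X Y Z x = wedgeOneTwo θ (fundForm J) x (X x) (Y x) (Z x)

/-- Twice `g(∇_X Y, Z)`, as given by the Koszul formula. -/
def koszul (X Y Z : Π x : M, TangentSpace 𝓘(ℝ, E) x) (x : M) : ℝ :=
  dirDeriv X (fun y ↦ inner ℝ (Y y) (Z y)) x + dirDeriv Y (fun y ↦ inner ℝ (X y) (Z y)) x
    - dirDeriv Z (fun y ↦ inner ℝ (X y) (Y y)) x
    + inner ℝ (mlieBracket 𝓘(ℝ, E) X Y x) (Z x) - inner ℝ (mlieBracket 𝓘(ℝ, E) X Z x) (Y x)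
    - inner ℝ (mlieBracket 𝓘(ℝ, E) Y Z x) (X x)

variable [IsContMDiffRiemannianBundle 𝓘(ℝ, E) ∞ E (fun x : M ↦ TangentSpace 𝓘(ℝ, E) x)]

theorem mdifferentiableAt_inner {x : M} {X Y : Π x : M, TangentSpace 𝓘(ℝ, E) x}
    (hX : MDiffAt (T% X) x) (hY : MDiffAt (T% Y) x) :
    MDifferentiableAt 𝓘(ℝ, E) 𝓘(ℝ) (fun y ↦ (inner ℝ (X y) (Y y) : ℝ)) x :=
  MDifferentiableAt.inner_bundle (E := fun x : M ↦ TangentSpace 𝓘(ℝ, E) x) hX hY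

theorem koszul_tensorial_left {x : M} {Y Z : Π x : M, TangentSpace 𝓘(ℝ, E) x}
    (hY : MDiffAt (T% Y) x) (hZ : MDiffAt (T% Z) x) :
    TensorialAt 𝓘(ℝ, E) E (fun X ↦ koszul X Y Z x) x where
  smul {f X} hf hX := by
    simp only [koszul, dirDeriv, dZero, Pi.smul_apply', inner_smul_left, RCLike.conj_to_real,
      mvfderiv_fun_mul hf (mdifferentiableAt_inner hX hZ), mvfderiv_fun_mul hf (mdifferentiableAt_inner hX hY),
      mlieBracket_smul_left hf hX, map_smul, inner_add_left, inner_smul_right]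
    simp
    ring
  add {X X'} hX hX' := by
    simp only [koszul, dirDeriv, dZero, Pi.add_apply, inner_add_left,
      mvfderiv_fun_add (mdifferentiableAt_inner hX hZ) (mdifferentiableAt_inner hX' hZ),
      mvfderiv_fun_add (mdifferentiableAt_inner hX hY) (mdifferentiableAt_inner hX' hY),
      mlieBracket_add_left hX hX', map_add, inner_add_right]
    simp
    ring

theorem koszul_tensorial_right {x : M} {X Y : Π x : M, TangentSpace 𝓘(ℝ, E) x}
    (hX : MDiffAt (T% X) x) (hY : MDiffAt (T% Y) x) :
    TensorialAt 𝓘(ℝ, E) E (fun Z ↦ koszul X Y Z x) x where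
  smul {f Z} hf hZ := by
    simp only [koszul, dirDeriv, dZero, Pi.smul_apply', inner_smul_right,
      mvfderiv_fun_mul hf (mdifferentiableAt_inner hX hZ), mvfderiv_fun_mul hf (mdifferentiableAt_inner hY hZ),
      mlieBracket_smul_right hf hZ, map_smul, inner_add_left, inner_smul_left, RCLike.conj_to_real]
    simp [real_inner_comm]
    ring
  add {Z Z'} hZ hZ' := by
    simp only [koszul, dirDeriv, dZero, Pi.add_apply, inner_add_right,
      mvfderiv_fun_add (mdifferentiableAt_inner hX hZ) (mdifferentiableAt_inner hX hZ'),
      mvfderiv_fun_add (mdifferentiableAt_inner hY hZ) (mdifferentiableAt_inner hY hZ'),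
      mlieBracket_add_right hZ hZ', map_add, inner_add_left]
    simp
    ring

open scoped Classical in
/-- The Levi-Civita connection as a bare function: for `Y` differentiable at `x`, the endomorphism
`u ↦ ∇_u Y` of the tangent space at `x` determined by the Koszul formula. (The value `0` where `Y`
is not differentiable is irrelevant.) -/
def leviCivitaFun (Y : Π x : M, TangentSpace 𝓘(ℝ, E) x) (x : M) :
    TangentSpace 𝓘(ℝ, E) x →L[ℝ] TangentSpace 𝓘(ℝ, E) x :=
  if hY : MDiffAt (T% Y) x then
    (2⁻¹ : ℝ) • LinearMap.toContinuousLinearMap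
      ((InnerProductSpace.toDual ℝ (TangentSpace 𝓘(ℝ, E) x)).symm.toLinearEquiv.toLinearMap ∘ₗ
        (TensorialAt.mkHom₂ (fun X Z ↦ koszul X Y Z x) x
          (fun _ hZ ↦ koszul_tensorial_left hY hZ)
          (fun _ hX ↦ koszul_tensorial_right hX hY)).toLinearMap)
  else 0

/-- The Koszul formula characterizing the Levi-Civita connection. -/
theorem inner_leviCivitaFun {x : M} {X Y Z : Π x : M, TangentSpace 𝓘(ℝ, E) x}
    (hX : MDiffAt (T% X) x) (hY : MDiffAt (T% Y) x) (hZ : MDiffAt (T% Z) x) :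
    inner ℝ (leviCivitaFun Y x (X x)) (Z x) = 2⁻¹ * koszul X Y Z x := by
  rw [leviCivitaFun, dif_pos hY]
  have := TensorialAt.mkHom₂_apply (Φ := fun X Z ↦ koszul X Y Z x)
          (fun _ hZ ↦ koszul_tensorial_left hY hZ)
          (fun _ hX ↦ koszul_tensorial_right hX hY) hX hZ
  simp [inner_smul_left, ← this]

theorem leviCivitaFun_ext {x : M} {Y : Π x : M, TangentSpace 𝓘(ℝ, E) x}
    {A : TangentSpace 𝓘(ℝ, E) x →L[ℝ] TangentSpace 𝓘(ℝ, E) x} (hY : MDiffAt (T% Y) x)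
    (h : ∀ X Z : Π x : M, TangentSpace 𝓘(ℝ, E) x, MDiffAt (T% X) x → MDiffAt (T% Z) x →
      2⁻¹ * koszul X Y Z x = inner ℝ (A (X x)) (Z x)) : leviCivitaFun Y x = A := by
  ext u
  refine ext_inner_right ℝ fun v ↦ ?_
  have hu := FiberBundle.mdifferentiableAt_extend 𝓘(ℝ, E) E u
  have hv := FiberBundle.mdifferentiableAt_extend 𝓘(ℝ, E) E v
  have := h _ _ hu hv
  rw [← inner_leviCivitaFun hu hY hv] at this
  simpa using this

/-- The Levi-Civita connection of the metric. -/
def leviCivita : CovariantDerivative 𝓘(ℝ, E) E (fun x : M ↦ TangentSpace 𝓘(ℝ, E) x) where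
  toFun := leviCivitaFun
  isCovariantDerivativeOnUniv :=
    { add := by
        intro Y Y' x hY hY' _
        refine leviCivitaFun_ext (mdifferentiableAt_add_section hY hY') fun X Z hX hZ ↦ ?_
        rw [add_apply, inner_add_left, inner_leviCivitaFun hX hY hZ,
          inner_leviCivitaFun hX hY' hZ]
        simp only [koszul, dirDeriv, dZero, Pi.add_apply, inner_add_left, inner_add_right,
          mvfderiv_fun_add (mdifferentiableAt_inner hY hZ) (mdifferentiableAt_inner hY' hZ),
          mvfderiv_fun_add (mdifferentiableAt_inner hX hY) (mdifferentiableAt_inner hX hY'),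
          mlieBracket_add_left hY hY', mlieBracket_add_right hY hY', map_add,
          add_apply]
        ring
      leibniz := by
        intro Y f x hY hf _
        refine leviCivitaFun_ext (hf.smul_section hY) fun X Z hX hZ ↦ ?_
        rw [add_apply, inner_add_left, smul_apply,
          real_inner_smul_left, inner_leviCivitaFun hX hY hZ,
          ContinuousLinearMap.smulRight_apply, real_inner_smul_left]
        simp only [koszul, dirDeriv, dZero, Pi.smul_apply', real_inner_smul_left,
          real_inner_smul_right,
          mvfderiv_fun_mul hf (mdifferentiableAt_inner hY hZ),
          mvfderiv_fun_mul hf (mdifferentiableAt_inner hX hY),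
          mlieBracket_smul_left hf hY, mlieBracket_smul_right hf hY, map_smul, inner_add_left]
        simp [real_inner_comm]
        ring }

theorem leviCivita_torsion :
    (leviCivita : CovariantDerivative 𝓘(ℝ, E) E (fun x : M ↦ TangentSpace 𝓘(ℝ, E) x)).torsion
      = 0 := by
  rw [CovariantDerivative.torsion_eq_zero_iff]
  intro X Y x hX hY
  refine ext_inner_right ℝ fun v ↦ ?_
  have hv := FiberBundle.mdifferentiableAt_extend 𝓘(ℝ, E) E v
  have h1 := inner_leviCivitaFun hX hY hv
  have h2 := inner_leviCivitaFun hY hX hv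
  simp only [FiberBundle.extend_apply_self] at h1 h2
  rw [inner_sub_left]
  change inner ℝ (leviCivitaFun Y x (X x)) v - inner ℝ (leviCivitaFun X x (Y x)) v = _
  rw [h1, h2, koszul, koszul, mlieBracket_swap_apply (V := Y) (W := X)]
  simp [real_inner_comm]
  ring

theorem leviCivita_metric {x : M} {X Y Z : Π x : M, TangentSpace 𝓘(ℝ, E) x}
    (hX : MDiffAt (T% X) x) (hY : MDiffAt (T% Y) x) (hZ : MDiffAt (T% Z) x) :
    dirDeriv X (fun y ↦ inner ℝ (Y y) (Z y)) x =
      inner ℝ (leviCivita Y x (X x)) (Z x) + inner ℝ (Y x) (leviCivita Z x (X x)) := by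
  have h1 := inner_leviCivitaFun hX hY hZ
  have h2 := inner_leviCivitaFun hX hZ hY
  change _ = inner ℝ (leviCivitaFun Y x (X x)) (Z x) + inner ℝ (Y x) (leviCivitaFun Z x (X x))
  rw [real_inner_comm _ (Y x), h1, h2, koszul, koszul, mlieBracket_swap_apply (V := Z) (W := Y)]
  simp [real_inner_comm, dirDeriv, dZero]
  ring

end Metric

end LCK

end

open Bundle VectorField
open scoped Manifold ContDiff

namespace LCK

/-! ### Calculus rules for directional derivatives of functions. -/

section DirDeriv

variable {E : Type*} [NormedAddCommGroup E] [NormedSpace ℝ E]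
  {M : Type*} [TopologicalSpace M] [ChartedSpace E M]

/-! The identity is `L_T` applied to a formula for `d(Jθ)`.

Since `θ` is closed, Cartan's formula gives `L_T θ = d(θ(T)) = d|θ|²`, and holomorphy of `T` turns
this into `L_T(Jθ) = Jd|θ|²` (`IsLCK.lieDeriv_JForm_lee`). As `d` commutes with `L_T`
(`dOne_lieDeriv`), `dJd|θ|² = L_T(d(Jθ))`.

Next, `Jθ` is the contraction of `ω` with `T`, so `d(Jθ)` is `L_T ω` minus the contraction of `dω =
θ ∧ ω`, that is `L_T ω - |θ|² ω + θ ∧ Jθ`. Closedness of `θ` makes `F` symmetric, so `L_T g =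
2g(F·,·)`, and with `L_T J = 0` this yields `L_T ω = 2ω(F·,·)` (`IsLCK.lieDeriv_fundForm`). This
proves `IsLCK.dOne_JForm_lee`.

Applying `L_T` once more by the product rule gives every term; `4ω(F²·,·)` comes from `L_T ω`
evaluated on `FX`. That needs `FX` to be smooth, which is the purpose of the Gram matrix argument.
-/

theorem dirDeriv_add (X : Π x : M, TangentSpace 𝓘(ℝ, E) x) {f g : M → ℝ} {x : M}
    (hf : MDifferentiableAt 𝓘(ℝ, E) 𝓘(ℝ) f x) (hg : MDifferentiableAt 𝓘(ℝ, E) 𝓘(ℝ) g x) :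
    dirDeriv X (fun y ↦ f y + g y) x = dirDeriv X f x + dirDeriv X g x := by
  simp only [dirDeriv, dZero, mvfderiv_fun_add hf hg, add_apply]

theorem dirDeriv_sub (X : Π x : M, TangentSpace 𝓘(ℝ, E) x) {f g : M → ℝ} {x : M}
    (hf : MDifferentiableAt 𝓘(ℝ, E) 𝓘(ℝ) f x) (hg : MDifferentiableAt 𝓘(ℝ, E) 𝓘(ℝ) g x) :
    dirDeriv X (fun y ↦ f y - g y) x = dirDeriv X f x - dirDeriv X g x := by
  simp only [dirDeriv, dZero, mvfderiv_fun_sub hf hg, sub_apply]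

theorem dirDeriv_mul (X : Π x : M, TangentSpace 𝓘(ℝ, E) x) {f g : M → ℝ} {x : M}
    (hf : MDifferentiableAt 𝓘(ℝ, E) 𝓘(ℝ) f x) (hg : MDifferentiableAt 𝓘(ℝ, E) 𝓘(ℝ) g x) :
    dirDeriv X (fun y ↦ f y * g y) x = f x * dirDeriv X g x + g x * dirDeriv X f x := by
  simp only [dirDeriv, dZero, mvfderiv_fun_mul hf hg, add_apply, smul_apply, smul_eq_mul]

theorem dirDeriv_neg (X : Π x : M, TangentSpace 𝓘(ℝ, E) x) (f : M → ℝ) (x : M) :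
    dirDeriv X (fun y ↦ -f y) x = -dirDeriv X f x := by
  simp only [dirDeriv, dZero, mvfderiv_fun_neg, neg_apply]

theorem dirDeriv_const_mul (X : Π x : M, TangentSpace 𝓘(ℝ, E) x) (c : ℝ) {f : M → ℝ} {x : M}
    (hf : MDifferentiableAt 𝓘(ℝ, E) 𝓘(ℝ) f x) :
    dirDeriv X (fun y ↦ c * f y) x = c * dirDeriv X f x := by
  simp only [dirDeriv, dZero, mvfderiv_fun_mul mdifferentiableAt_const hf, mvfderiv_const,
    smul_zero, add_zero, smul_apply, smul_eq_mul]

end DirDeriv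

/-! ### Smoothness of derivatives and brackets; the bracket as a commutator. -/

section Smooth

variable {E : Type*} [NormedAddCommGroup E] [NormedSpace ℝ E]
  {M : Type*} [TopologicalSpace M] [ChartedSpace E M] [IsManifold 𝓘(ℝ, E) ∞ M]

theorem contMDiffAt_dirDeriv {X : Π x : M, TangentSpace 𝓘(ℝ, E) x} {f : M → ℝ} {x : M}
    (hX : CMDiffAt ∞ (T% X) x) (hf : ContMDiffAt 𝓘(ℝ, E) 𝓘(ℝ) ∞ f x) :
    ContMDiffAt 𝓘(ℝ, E) 𝓘(ℝ) ∞ (dirDeriv X f) x := by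
  have hd := hf.mfderiv_const (m := ∞) (by simp)
  have h := ContMDiffAt.clm_apply_of_inCoordinates (n := ∞) (b₁ := fun y : M ↦ y) (b₂ := f)
    (v := X) (ϕ := fun y ↦ mfderiv 𝓘(ℝ, E) 𝓘(ℝ) f y) hd hX hf
  rw [contMDiffAt_totalSpace] at h
  have h2 := h.2
  -- The tangent bundle of `ℝ` is trivial, so the fibre coordinate is the derivative itself.
  simp only [trivializationAt_model_space_apply] at h2
  exact h2

theorem IsSmoothVF.contMDiff_dirDeriv {X : Π x : M, TangentSpace 𝓘(ℝ, E) x} {f : M → ℝ}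
    (hX : IsSmoothVF X) (hf : ContMDiff 𝓘(ℝ, E) 𝓘(ℝ) ∞ f) :
    ContMDiff 𝓘(ℝ, E) 𝓘(ℝ) ∞ (dirDeriv X f) :=
  fun x ↦ contMDiffAt_dirDeriv (hX x) (hf x)

theorem IsSmoothVF.mdifferentiableAt {X : Π x : M, TangentSpace 𝓘(ℝ, E) x} (hX : IsSmoothVF X)
    (x : M) : MDiffAt (T% X) x :=
  (hX x).mdifferentiableAt (by simp)

theorem IsSmoothEnd.apply {A : Π x : M, TangentSpace 𝓘(ℝ, E) x →L[ℝ] TangentSpace 𝓘(ℝ, E) x}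
    (hA : IsSmoothEnd A) {X : Π x : M, TangentSpace 𝓘(ℝ, E) x} (hX : IsSmoothVF X) :
    IsSmoothVF (fun y ↦ A y (X y)) :=
  ContMDiff.clm_bundle_apply (E₁ := fun x : M ↦ TangentSpace 𝓘(ℝ, E) x)
    (E₂ := fun x : M ↦ TangentSpace 𝓘(ℝ, E) x) hA hX

theorem contMDiffAt_mlieBracket [CompleteSpace E] {X Y : Π x : M, TangentSpace 𝓘(ℝ, E) x} {x : M}
    (hX : CMDiffAt ∞ (T% X) x) (hY : CMDiffAt ∞ (T% Y) x) :
    CMDiffAt ∞ (T% (mlieBracket 𝓘(ℝ, E) X Y)) x := by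
  -- The bracket costs one derivative, which is harmless because `∞ + 1 = ∞`.
  have : IsManifold 𝓘(ℝ, E) (((⊤ : ℕ∞) : WithTop ℕ∞) + 1) M := ‹IsManifold 𝓘(ℝ, E) ∞ M›
  have : IsManifold 𝓘(ℝ, E) (minSmoothness ℝ 2) M := by
    rw [minSmoothness_of_isRCLikeNormedField]; infer_instance
  exact ContMDiffAt.mlieBracket_vectorField (m := ⊤) (n := ⊤) hX hY (by simp)

theorem IsSmoothVF.mlieBracket [CompleteSpace E] {X Y : Π x : M, TangentSpace 𝓘(ℝ, E) x}
    (hX : IsSmoothVF X) (hY : IsSmoothVF Y) : IsSmoothVF (mlieBracket 𝓘(ℝ, E) X Y) :=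
  fun x ↦ contMDiffAt_mlieBracket (hX x) (hY x)

theorem mlieBracket_jacobi [CompleteSpace E] {U V W : Π x : M, TangentSpace 𝓘(ℝ, E) x} {x : M}
    (hU : CMDiffAt ∞ (T% U) x) (hV : CMDiffAt ∞ (T% V) x) (hW : CMDiffAt ∞ (T% W) x) :
    mlieBracket 𝓘(ℝ, E) U (mlieBracket 𝓘(ℝ, E) V W) x =
      mlieBracket 𝓘(ℝ, E) (mlieBracket 𝓘(ℝ, E) U V) W x
        + mlieBracket 𝓘(ℝ, E) V (mlieBracket 𝓘(ℝ, E) U W) x := by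
  have : IsManifold 𝓘(ℝ, E) (minSmoothness ℝ 3) M := by
    rw [minSmoothness_of_isRCLikeNormedField]; infer_instance
  have h2 : minSmoothness ℝ 2 ≤ ∞ := by
    rw [minSmoothness_of_isRCLikeNormedField]; exact ENat.LEInfty.out
  exact leibniz_identity_mlieBracket_apply (hU.of_le h2) (hV.of_le h2) (hW.of_le h2)

/-- The Leibniz rule on a neighbourhood rather than at a point, so that the result can be bracketed
again. -/
theorem mlieBracket_smul_eventuallyEq [CompleteSpace E] {W Z : Π x : M, TangentSpace 𝓘(ℝ, E) x}
    {f : M → ℝ} {x : M} (hf : ContMDiff 𝓘(ℝ, E) 𝓘(ℝ) ∞ f)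
    (hZ : ∀ᶠ y in nhds x, MDiffAt (T% Z) y) :
    mlieBracket 𝓘(ℝ, E) W (f • Z) =ᶠ[nhds x]
      dirDeriv W f • Z + f • mlieBracket 𝓘(ℝ, E) W Z := by
  filter_upwards [hZ] with y hy
  exact mlieBracket_smul_right ((hf y).mdifferentiableAt (by simp)) hy

/-- The Lie bracket acts on functions as the commutator of directional derivatives. -/
theorem dirDeriv_mlieBracket [CompleteSpace E] {U V : Π x : M, TangentSpace 𝓘(ℝ, E) x} {f : M → ℝ}
    (hU : IsSmoothVF U) (hV : IsSmoothVF V) (hf : ContMDiff 𝓘(ℝ, E) 𝓘(ℝ) ∞ f) (x : M) :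
    dirDeriv (mlieBracket 𝓘(ℝ, E) U V) f x =
      dirDeriv U (dirDeriv V f) x - dirDeriv V (dirDeriv U f) x := by
  -- The idea is to compare the Jacobi identities for `U, V, f • Z` and for `U, V, Z`: the
  -- difference is the claim times `Z x`. This needs a nonzero tangent vector; in dimension zero
  -- both sides vanish.
  by_cases hE : Subsingleton (TangentSpace 𝓘(ℝ, E) x)
  · simp [dirDeriv, Subsingleton.elim _ (0 : TangentSpace 𝓘(ℝ, E) x)]
  rw [not_subsingleton_iff_nontrivial] at hE
  obtain ⟨v, hv⟩ := exists_ne (0 : TangentSpace 𝓘(ℝ, E) x)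
  set Z := FiberBundle.extend E v with hZdef
  have hZx : Z x = v := by simp [hZdef]
  have hZ : CMDiffAt ∞ (T% Z) x := FiberBundle.contMDiffAt_extend 𝓘(ℝ, E) E v
  have hZev : ∀ᶠ y in nhds x, MDiffAt (T% Z) y := by
    obtain ⟨s, hs, hsm⟩ := FiberBundle.exists_contMDiffOn_extend 𝓘(ℝ, E) E (k := ∞) v
    filter_upwards [eventually_mem_nhds_iff.2 hs] with y hy
    exact (hsm.contMDiffAt hy).mdifferentiableAt (by simp)
  have hmd : ∀ {h : M → ℝ}, ContMDiff 𝓘(ℝ, E) 𝓘(ℝ) ∞ h → MDifferentiableAt 𝓘(ℝ, E) 𝓘(ℝ) h x :=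
    fun hh ↦ (hh x).mdifferentiableAt (by simp)
  have hbr : ∀ {W : Π x : M, TangentSpace 𝓘(ℝ, E) x}, IsSmoothVF W →
      MDiffAt (T% (mlieBracket 𝓘(ℝ, E) W Z)) x :=
    fun hW ↦ (contMDiffAt_mlieBracket (hW x) hZ).mdifferentiableAt (by simp)
  -- The two mixed terms together are symmetric in `P` and `Q`, so they cancel in the commutator.
  have expand : ∀ {P Q : Π x : M, TangentSpace 𝓘(ℝ, E) x}, IsSmoothVF P → IsSmoothVF Q →
      mlieBracket 𝓘(ℝ, E) P (mlieBracket 𝓘(ℝ, E) Q (f • Z)) x =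
        dirDeriv P (dirDeriv Q f) x • v + dirDeriv Q f x • mlieBracket 𝓘(ℝ, E) P Z x
          + (dirDeriv P f x • mlieBracket 𝓘(ℝ, E) Q Z x
            + f x • mlieBracket 𝓘(ℝ, E) P (mlieBracket 𝓘(ℝ, E) Q Z) x) := by
    intro P Q hP hQ
    have hQf := hmd (hQ.contMDiff_dirDeriv hf)
    rw [Filter.EventuallyEq.mlieBracket_vectorField_eq (Filter.EventuallyEq.refl _ P)
        (mlieBracket_smul_eventuallyEq hf hZev),
      mlieBracket_add_right (hQf.smul_section (hZ.mdifferentiableAt (by simp)))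
        ((hmd hf).smul_section (hbr hQ)),
      mlieBracket_smul_right hQf (hZ.mdifferentiableAt (by simp)),
      mlieBracket_smul_right (hmd hf) (hbr hQ), hZx]
    rfl
  have hfZ : CMDiffAt ∞ (T% (f • Z)) x := (hf x).smul_section hZ
  have J1 := mlieBracket_jacobi (hU x) (hV x) hfZ
  have J2 := mlieBracket_jacobi (hU x) (hV x) hZ
  have h3 := (mlieBracket_smul_eventuallyEq (W := mlieBracket 𝓘(ℝ, E) U V) hf hZev).eq_of_nhds
  rw [expand hU hV, expand hV hU, h3, J2] at J1
  simp only [Pi.add_apply, Pi.smul_apply', hZx] at J1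
  refine smul_left_injective ℝ hv ?_
  simp only [sub_smul]
  linear_combination (norm := module) (-1 : ℝ) • J1

end Smooth

/-! ### Commutation of `d` and `L_T` on `1`-forms. -/

section LieDerivative

variable {E : Type*} [NormedAddCommGroup E] [NormedSpace ℝ E] [CompleteSpace E]
  {M : Type*} [TopologicalSpace M] [ChartedSpace E M] [IsManifold 𝓘(ℝ, E) ∞ M]

/-- The exterior derivative commutes with the Lie derivative: if `β = L_T α`, then
`dβ = L_T (dα)`. -/
theorem dOne_lieDeriv {α β : Π x : M, TangentSpace 𝓘(ℝ, E) x →L[ℝ] ℝ}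
    {T X Y : Π x : M, TangentSpace 𝓘(ℝ, E) x}
    (hα : ∀ Z : Π x : M, TangentSpace 𝓘(ℝ, E) x, IsSmoothVF Z →
      ContMDiff 𝓘(ℝ, E) 𝓘(ℝ) ∞ (fun y ↦ α y (Z y)))
    (hT : IsSmoothVF T)
    (hβ : ∀ Z : Π x : M, TangentSpace 𝓘(ℝ, E) x, IsSmoothVF Z → ∀ y,
      β y (Z y) = dirDeriv T (fun z ↦ α z (Z z)) y - α y (mlieBracket 𝓘(ℝ, E) T Z y))
    (hX : IsSmoothVF X) (hY : IsSmoothVF Y) (x : M) :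
    dOne β X Y x = dirDeriv T (dOne α X Y) x - dOne α (mlieBracket 𝓘(ℝ, E) T X) Y x
      - dOne α X (mlieBracket 𝓘(ℝ, E) T Y) x := by
  have hmd : ∀ {h : M → ℝ}, ContMDiff 𝓘(ℝ, E) 𝓘(ℝ) ∞ h → MDifferentiableAt 𝓘(ℝ, E) 𝓘(ℝ) h x :=
    fun hh ↦ (hh x).mdifferentiableAt (by simp)
  have hTX := hT.mlieBracket hX
  have hTY := hT.mlieBracket hY
  have hXY := hX.mlieBracket hY
  have eX : (fun y ↦ β y (X y)) = fun y ↦ dirDeriv T (fun z ↦ α z (X z)) y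
      - α y (mlieBracket 𝓘(ℝ, E) T X y) := funext (hβ X hX)
  have eY : (fun y ↦ β y (Y y)) = fun y ↦ dirDeriv T (fun z ↦ α z (Y z)) y
      - α y (mlieBracket 𝓘(ℝ, E) T Y y) := funext (hβ Y hY)
  have eT : dirDeriv T (dOne α X Y) x = dirDeriv T (dirDeriv X fun z ↦ α z (Y z)) x
      - dirDeriv T (dirDeriv Y fun z ↦ α z (X z)) x
      - dirDeriv T (fun y ↦ α y (mlieBracket 𝓘(ℝ, E) X Y y)) x := by
    rw [← dirDeriv_sub T (hmd (hX.contMDiff_dirDeriv (hα Y hY)))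
        (hmd (hY.contMDiff_dirDeriv (hα X hX))),
      ← dirDeriv_sub T (hmd ((hX.contMDiff_dirDeriv (hα Y hY)).sub
        (hY.contMDiff_dirDeriv (hα X hX)))) (hmd (hα _ hXY))]
    rfl
  rw [eT, dOne, eX, eY, hβ _ hXY,
    dirDeriv_sub X (hmd (hT.contMDiff_dirDeriv (hα Y hY))) (hmd (hα _ hTY)),
    dirDeriv_sub Y (hmd (hT.contMDiff_dirDeriv (hα X hX))) (hmd (hα _ hTX)),
    mlieBracket_jacobi (hT x) (hX x) (hY x), map_add]
  simp only [dOne]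
  -- Jacobi has matched the bracket terms; the second derivatives differ only by the commutators of
  -- `T` with `X` and with `Y`.
  rw [dirDeriv_mlieBracket hT hX (hα Y hY), dirDeriv_mlieBracket hT hY (hα X hX)]
  ring

end LieDerivative

/-! ### Smoothness of the metric pairing. -/

section Metric

variable {E : Type*} [NormedAddCommGroup E] [NormedSpace ℝ E]
  {M : Type*} [TopologicalSpace M] [ChartedSpace E M] [IsManifold 𝓘(ℝ, E) ∞ M]
  [RiemannianBundle (fun x : M ↦ TangentSpace 𝓘(ℝ, E) x)]
  [IsContMDiffRiemannianBundle 𝓘(ℝ, E) ∞ E (fun x : M ↦ TangentSpace 𝓘(ℝ, E) x)]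

theorem contMDiffAt_inner {X Y : Π x : M, TangentSpace 𝓘(ℝ, E) x} {x : M}
    (hX : CMDiffAt ∞ (T% X) x) (hY : CMDiffAt ∞ (T% Y) x) :
    ContMDiffAt 𝓘(ℝ, E) 𝓘(ℝ) ∞ (fun y ↦ (inner ℝ (X y) (Y y) : ℝ)) x :=
  ContMDiffAt.inner_bundle (E := fun x : M ↦ TangentSpace 𝓘(ℝ, E) x) hX hY

theorem IsSmoothVF.inner {X Y : Π x : M, TangentSpace 𝓘(ℝ, E) x}
    (hX : IsSmoothVF X) (hY : IsSmoothVF Y) :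
    ContMDiff 𝓘(ℝ, E) 𝓘(ℝ) ∞ (fun y ↦ (inner ℝ (X y) (Y y) : ℝ)) :=
  fun x ↦ contMDiffAt_inner (hX x) (hY x)

end Metric

/-! ### Smoothness of covariant derivatives, through Gram matrices of local frames. -/

section Frame

theorem contMDiffAt_det {E : Type*} [NormedAddCommGroup E] [NormedSpace ℝ E]
    {M : Type*} [TopologicalSpace M] [ChartedSpace E M]
    {ι : Type*} [Fintype ι] [DecidableEq ι] {A : M → Matrix ι ι ℝ} {x : M}
    (hA : ∀ i j, ContMDiffAt 𝓘(ℝ, E) 𝓘(ℝ) ∞ (fun y ↦ A y i j) x) :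
    ContMDiffAt 𝓘(ℝ, E) 𝓘(ℝ) ∞ (fun y ↦ (A y).det) x := by
  simp only [Matrix.det_apply']
  exact contMDiffAt_finsetSum fun σ _ ↦ contMDiffAt_const.mul
    (contMDiffAt_finsetProd fun i _ ↦ hA _ _)

/-- A kernel vector of the Gram matrix gives a vector orthogonal to the whole basis, hence zero. -/
theorem det_gram_ne_zero {V : Type*} [NormedAddCommGroup V] [InnerProductSpace ℝ V]
    {ι : Type*} [Fintype ι] [DecidableEq ι] (b : Module.Basis ι ℝ V) :
    (Matrix.of fun i j ↦ (inner ℝ (b i) (b j) : ℝ)).det ≠ 0 := by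
  intro h
  obtain ⟨c, hc, h0⟩ := Matrix.exists_mulVec_eq_zero_iff.2 h
  have hi : ∀ i, inner ℝ (b i) (∑ j, c j • b j) = 0 := by
    intro i
    have := congrFun h0 i
    simp only [Matrix.mulVec, dotProduct, Matrix.of_apply, Pi.zero_apply] at this
    rw [inner_sum, ← this]
    exact Finset.sum_congr rfl fun j _ ↦ by rw [real_inner_smul_right, mul_comm]
  have hz : ∑ j, c j • b j = 0 :=
    InnerProductSpace.ext_inner_left_basis b fun i ↦ by rw [hi, inner_zero_right]
  exact hc (funext (Fintype.linearIndependent_iff.1 b.linearIndependent c hz))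

/-- Cramer's rule for the coordinates of a vector in terms of its inner products with a basis. -/
theorem det_gram_mul_repr {V : Type*} [NormedAddCommGroup V] [InnerProductSpace ℝ V]
    {ι : Type*} [Fintype ι] [DecidableEq ι] (b : Module.Basis ι ℝ V) (v : V) (i : ι) :
    (Matrix.of fun i j ↦ (inner ℝ (b i) (b j) : ℝ)).det * b.repr v i =
      ((Matrix.of fun i j ↦ (inner ℝ (b i) (b j) : ℝ)).updateCol i
        fun j ↦ inner ℝ (b j) v).det := by
  have hv : (fun j ↦ (inner ℝ (b j) v : ℝ)) =
      (Matrix.of fun i j ↦ (inner ℝ (b i) (b j) : ℝ)).mulVec (b.repr v) := by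
    ext j
    conv_lhs => rw [← b.sum_repr v]
    simp only [Matrix.mulVec, dotProduct, Matrix.of_apply]
    rw [inner_sum]
    exact Finset.sum_congr rfl fun k _ ↦ by rw [real_inner_smul_right, mul_comm]
  rw [← Matrix.cramer_apply, hv, Matrix.cramer_eq_adjugate_mulVec, Matrix.mulVec_mulVec,
    Matrix.adjugate_mul, Matrix.smul_mulVec, Matrix.one_mulVec]
  rfl

variable {E : Type*} [NormedAddCommGroup E] [NormedSpace ℝ E] [FiniteDimensional ℝ E]
  {M : Type*} [TopologicalSpace M] [ChartedSpace E M] [IsManifold 𝓘(ℝ, E) ∞ M]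
  [RiemannianBundle (fun x : M ↦ TangentSpace 𝓘(ℝ, E) x)]
  [IsContMDiffRiemannianBundle 𝓘(ℝ, E) ∞ E (fun x : M ↦ TangentSpace 𝓘(ℝ, E) x)]

/-- A vector field is smooth if its inner products with all locally defined smooth vector fields
are. -/
theorem contMDiffAt_of_inner {V : Π x : M, TangentSpace 𝓘(ℝ, E) x} {x : M}
    (h : ∀ Z : Π x : M, TangentSpace 𝓘(ℝ, E) x, (∀ᶠ y in nhds x, CMDiffAt ∞ (T% Z) y) →
      ContMDiffAt 𝓘(ℝ, E) 𝓘(ℝ) ∞ (fun y ↦ (inner ℝ (Z y) (V y) : ℝ)) x) :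
    CMDiffAt ∞ (T% V) x := by
  set e := trivializationAt E (fun x : M ↦ TangentSpace 𝓘(ℝ, E) x) x with he
  set b := Module.finBasis ℝ E
  have hx : x ∈ e.baseSet := FiberBundle.mem_baseSet_trivializationAt' x
  have hnear : ∀ᶠ y in nhds x, y ∈ e.baseSet := e.open_baseSet.mem_nhds hx
  have hs : ∀ i, ∀ y ∈ e.baseSet, CMDiffAt ∞ (T% (e.localFrame b i)) y :=
    fun i y hy ↦ contMDiffAt_localFrame_of_mem ∞ e b i hy
  have hsV : ∀ i, ContMDiffAt 𝓘(ℝ, E) 𝓘(ℝ) ∞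
      (fun y ↦ (inner ℝ (e.localFrame b i y) (V y) : ℝ)) x :=
    fun i ↦ h _ (hnear.mono (hs i))
  have hss : ∀ i j, ContMDiffAt 𝓘(ℝ, E) 𝓘(ℝ) ∞
      (fun y ↦ (inner ℝ (e.localFrame b i y) (e.localFrame b j y) : ℝ)) x :=
    fun i j ↦ contMDiffAt_inner (hs i x hx) (hs j x hx)
  set G : M → Matrix (Fin (Module.finrank ℝ E)) (Fin (Module.finrank ℝ E)) ℝ :=
    fun y ↦ Matrix.of fun i j ↦ inner ℝ (e.localFrame b i y) (e.localFrame b j y) with hG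
  -- Cramer's rule: near `x` these are the frame coordinates of `V`, written as quotients of
  -- polynomials in inner products already known to be smooth.
  set c : Fin (Module.finrank ℝ E) → M → ℝ := fun i y ↦
    ((G y).updateCol i fun j ↦ inner ℝ (e.localFrame b j y) (V y)).det / (G y).det with hc
  have hGy : ∀ y (hy : y ∈ e.baseSet),
      G y = Matrix.of fun i j ↦ inner ℝ (e.basisAt b hy i) (e.basisAt b hy j) := by
    intro y hy
    ext i j
    simp [hG, hy]
  have hdet : ∀ y ∈ e.baseSet, (G y).det ≠ 0 := by
    intro y hy
    rw [hGy y hy]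
    exact det_gram_ne_zero _
  have hcs : ∀ i, ContMDiffAt 𝓘(ℝ, E) 𝓘(ℝ) ∞ (c i) x := by
    intro i
    refine ContMDiffAt.div₀ (contMDiffAt_det fun k l ↦ ?_) (contMDiffAt_det hss) (hdet x hx)
    by_cases hl : l = i
    · subst hl
      simpa using hsV k
    · simp only [Matrix.updateCol_ne hl]
      exact hss k l
  have hsum : CMDiffAt ∞ (T% (fun y ↦ ∑ i, c i y • e.localFrame b i y)) x :=
    ContMDiffAt.sum_section fun i _ ↦ (hcs i).smul_section (hs i x hx)
  refine hsum.congr_of_eventuallyEq ?_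
  filter_upwards [hnear] with y hy
  congr 1
  conv_lhs => rw [← (e.basisAt b hy).sum_repr (V y)]
  refine Finset.sum_congr rfl fun i _ ↦ ?_
  have := det_gram_mul_repr (e.basisAt b hy) (V y) i
  rw [← hGy y hy] at this
  rw [e.localFrame_apply_of_mem_baseSet b hy]
  congr 1
  rw [hc, eq_div_iff (hdet y hy), mul_comm, this]
  simp [hy]

/-- Covariant derivatives of smooth vector fields are smooth. -/
theorem IsSmoothVF.leviCivita {X Y : Π x : M, TangentSpace 𝓘(ℝ, E) x}
    (hX : IsSmoothVF X) (hY : IsSmoothVF Y) : IsSmoothVF (fun y ↦ leviCivita Y y (X y)) := by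
  have : CompleteSpace E := FiniteDimensional.complete ℝ E
  intro x
  refine contMDiffAt_of_inner fun Z hZ ↦ ?_
  have hZx := hZ.self_of_nhds
  -- Each term of the Koszul formula is smooth at `x`, even though `Z` is smooth only nearby.
  have hk : ContMDiffAt 𝓘(ℝ, E) 𝓘(ℝ) ∞ (fun y ↦ 2⁻¹ * koszul X Y Z y) x := by
    refine contMDiffAt_const.mul ?_
    refine (((((contMDiffAt_dirDeriv (hX x) (contMDiffAt_inner (hY x) hZx)).add
      (contMDiffAt_dirDeriv (hY x) (contMDiffAt_inner (hX x) hZx))).sub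
      (contMDiffAt_dirDeriv hZx (contMDiffAt_inner (hX x) (hY x)))).add
      (contMDiffAt_inner (contMDiffAt_mlieBracket (hX x) (hY x)) hZx)).sub
      (contMDiffAt_inner (contMDiffAt_mlieBracket (hX x) hZx) (hY x))).sub
      (contMDiffAt_inner (contMDiffAt_mlieBracket (hY x) hZx) (hX x))
  refine hk.congr_of_eventuallyEq ?_
  filter_upwards [hZ] with y hy
  rw [real_inner_comm]
  exact inner_leviCivitaFun (hX.mdifferentiableAt y) (hY.mdifferentiableAt y)
    (hy.mdifferentiableAt (by simp))

end Frame

/-! ### The Lee field and its pairing with `θ`. -/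

section Sharp

variable {E : Type*} [NormedAddCommGroup E] [NormedSpace ℝ E] [FiniteDimensional ℝ E]
  {M : Type*} [TopologicalSpace M] [ChartedSpace E M]
  [RiemannianBundle (fun x : M ↦ TangentSpace 𝓘(ℝ, E) x)]

theorem inner_sharp_left (θ : Π x : M, TangentSpace 𝓘(ℝ, E) x →L[ℝ] ℝ) (x : M)
    (u : TangentSpace 𝓘(ℝ, E) x) : inner ℝ (sharp θ x) u = θ x u :=
  InnerProductSpace.toDual_symm_apply

theorem normSq_eq_apply_sharp (θ : Π x : M, TangentSpace 𝓘(ℝ, E) x →L[ℝ] ℝ) (x : M) :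
    normSq θ x = θ x (sharp θ x) := by
  rw [← inner_sharp_left, real_inner_self_eq_norm_sq, normSq, sharp, LinearIsometryEquiv.norm_map]

end Sharp

theorem IsHolomorphicVF.mlieBracket_map
    {E : Type*} [NormedAddCommGroup E] [NormedSpace ℝ E]
    {M : Type*} [TopologicalSpace M] [ChartedSpace E M] [IsManifold 𝓘(ℝ, E) ∞ M]
    {J : Π x : M, TangentSpace 𝓘(ℝ, E) x →L[ℝ] TangentSpace 𝓘(ℝ, E) x}
    {T X : Π x : M, TangentSpace 𝓘(ℝ, E) x}
    (hhol : IsHolomorphicVF J T) (hX : IsSmoothVF X) (x : M) :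
    mlieBracket 𝓘(ℝ, E) T (fun y ↦ J y (X y)) x = J x (mlieBracket 𝓘(ℝ, E) T X x) :=
  sub_eq_zero.1 (hhol.2 X hX x)

/-! ### Lie derivatives of `θ`, `Jθ`, `g` and `ω` along the Lee field, and the formula for `d(Jθ)`.
-/

section Lee

variable {E : Type*} [NormedAddCommGroup E] [NormedSpace ℝ E]
  {M : Type*} [TopologicalSpace M] [ChartedSpace E M] [IsManifold 𝓘(ℝ, E) ∞ M]
  [RiemannianBundle (fun x : M ↦ TangentSpace 𝓘(ℝ, E) x)]
  {J : Π x : M, TangentSpace 𝓘(ℝ, E) x →L[ℝ] TangentSpace 𝓘(ℝ, E) x}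
  {θ : Π x : M, TangentSpace 𝓘(ℝ, E) x →L[ℝ] ℝ} {T X Y : Π x : M, TangentSpace 𝓘(ℝ, E) x}

theorem IsHermitian.inner_map_left (h : IsHermitian J) (x : M) (u v : TangentSpace 𝓘(ℝ, E) x) :
    inner ℝ (J x u) v = -inner ℝ u (J x v) := by
  rw [← h.inner_map_map x u (J x v), h.complex.sq, inner_neg_right, neg_neg]

theorem IsHermitian.fundForm_swap (h : IsHermitian J) (x : M) (u v : TangentSpace 𝓘(ℝ, E) x) :
    fundForm J x u v = -fundForm J x v u := by
  rw [fundForm, fundForm, h.inner_map_left, real_inner_comm]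

variable [FiniteDimensional ℝ E]

/-- The contraction of the fundamental form with the Lee vector field is `J θ`. -/
theorem IsHermitian.fundForm_sharp_left (h : IsHermitian J) (x : M) (u : TangentSpace 𝓘(ℝ, E) x) :
    fundForm J x (sharp θ x) u = JForm J θ x u := by
  rw [fundForm, h.inner_map_left, inner_sharp_left]
  rfl

/-- Cartan's formula `L_T θ = d(θ(T))` for the closed form `θ`. -/
theorem IsLCK.lieDeriv_lee (hlck : IsLCK J θ) (hT : IsSmoothVF (sharp θ)) (hX : IsSmoothVF X)
    (x : M) :
    dirDeriv (sharp θ) (fun y ↦ θ y (X y)) x - θ x (mlieBracket 𝓘(ℝ, E) (sharp θ) X x) =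
      dZero (normSq θ) x (X x) := by
  have h := hlck.closed _ _ hT hX x
  have e : normSq θ = fun y ↦ θ y (sharp θ y) := funext (normSq_eq_apply_sharp θ)
  rw [e]
  simp only [dOne, dirDeriv] at h ⊢
  linarith

/-- `L_T (J θ) = J d|θ|²` for a holomorphic Lee field. -/
theorem IsLCK.lieDeriv_JForm_lee (hlck : IsLCK J θ) (hhol : IsHolomorphicVF J (sharp θ))
    (hX : IsSmoothVF X) (x : M) :
    JForm J (dZero (normSq θ)) x (X x) =
      dirDeriv (sharp θ) (fun y ↦ JForm J θ y (X y)) x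
        - JForm J θ x (mlieBracket 𝓘(ℝ, E) (sharp θ) X x) := by
  -- Evaluate `L_T θ = d|θ|²` on `JX`; holomorphy then moves `J` out of the bracket.
  have h := hlck.lieDeriv_lee hhol.1 (hlck.hermitian.complex.smooth.apply hX) x
  rw [hhol.mlieBracket_map hX] at h
  have e : (fun y ↦ JForm J θ y (X y)) = fun y ↦ -θ y (J y (X y)) := rfl
  rw [e, dirDeriv_neg]
  change -dZero (normSq θ) x (J x (X x)) = _ - -θ x (J x _)
  linarith

variable [IsContMDiffRiemannianBundle 𝓘(ℝ, E) ∞ E (fun x : M ↦ TangentSpace 𝓘(ℝ, E) x)]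

theorem leviCivita_sub_leviCivita {x : M} (hX : MDiffAt (T% X) x) (hY : MDiffAt (T% Y) x) :
    leviCivita Y x (X x) - leviCivita X x (Y x) = mlieBracket 𝓘(ℝ, E) X Y x :=
  (CovariantDerivative.torsion_eq_zero_iff _).1 leviCivita_torsion hX hY

/-- The Lie derivative of the metric. -/
theorem lieDeriv_inner (hT : IsSmoothVF T) (hX : IsSmoothVF X) (hY : IsSmoothVF Y) (x : M) :
    dirDeriv T (fun y ↦ inner ℝ (X y) (Y y)) x - inner ℝ (mlieBracket 𝓘(ℝ, E) T X x) (Y x)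
      - inner ℝ (X x) (mlieBracket 𝓘(ℝ, E) T Y x) =
      inner ℝ (leviCivita T x (X x)) (Y x) + inner ℝ (X x) (leviCivita T x (Y x)) := by
  have hT' := hT.mdifferentiableAt x
  have hX' := hX.mdifferentiableAt x
  have hY' := hY.mdifferentiableAt x
  rw [leviCivita_metric hT' hX' hY', ← leviCivita_sub_leviCivita hT' hX',
    ← leviCivita_sub_leviCivita hT' hY', inner_sub_left, inner_sub_right]
  ring

/-- The covariant derivative of the dual of a closed form is symmetric. -/
theorem IsLCK.inner_leviCivita_lee_comm (hlck : IsLCK J θ) (hT : IsSmoothVF (sharp θ))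
    (hX : IsSmoothVF X) (hY : IsSmoothVF Y) (x : M) :
    inner ℝ (leviCivita (sharp θ) x (X x)) (Y x) =
      inner ℝ (X x) (leviCivita (sharp θ) x (Y x)) := by
  have h := hlck.closed X Y hX hY x
  have hT' := hT.mdifferentiableAt x
  have hX' := hX.mdifferentiableAt x
  have hY' := hY.mdifferentiableAt x
  simp only [dOne, ← inner_sharp_left] at h
  -- Metric compatibility and vanishing torsion reduce `dθ(X, Y)` to the antisymmetric part of `∇T`.
  rw [leviCivita_metric hX' hT' hY', leviCivita_metric hY' hT' hX',
    ← leviCivita_sub_leviCivita hX' hY', inner_sub_right] at h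
  rw [real_inner_comm (leviCivita (sharp θ) x (Y x))]
  linarith

/-- `L_T ω = 2 ω(F ·, ·)` for a holomorphic Lee field. -/
theorem IsLCK.lieDeriv_fundForm (hlck : IsLCK J θ) (hhol : IsHolomorphicVF J (sharp θ))
    (hX : IsSmoothVF X) (hY : IsSmoothVF Y) (x : M) :
    dirDeriv (sharp θ) (fun y ↦ fundForm J y (X y) (Y y)) x
      - fundForm J x (mlieBracket 𝓘(ℝ, E) (sharp θ) X x) (Y x)
      - fundForm J x (X x) (mlieBracket 𝓘(ℝ, E) (sharp θ) Y x) =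
      2 * fundForm J x (leviCivita (sharp θ) x (X x)) (Y x) := by
  have hJY := hlck.hermitian.complex.smooth.apply hY
  -- Since `ω(X, Y) = -g(X, JY)` and `L_T` commutes with `J`, it suffices to know `L_T g` on `(X,
  -- JY)`; symmetry of `∇T` merges its two terms, whence the factor `2`.
  have h := lieDeriv_inner hhol.1 hX hJY x
  rw [hhol.mlieBracket_map hY, ← hlck.inner_leviCivita_lee_comm hhol.1 hX hJY] at h
  have e : (fun y ↦ fundForm J y (X y) (Y y)) = fun y ↦ -inner ℝ (X y) (J y (Y y)) :=
    funext fun y ↦ hlck.hermitian.inner_map_left y _ _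
  rw [e, dirDeriv_neg]
  simp only [fundForm, hlck.hermitian.inner_map_left]
  linarith

theorem IsLCK.contMDiff_JForm (hlck : IsLCK J θ) (hT : IsSmoothVF (sharp θ)) (hX : IsSmoothVF X) :
    ContMDiff 𝓘(ℝ, E) 𝓘(ℝ) ∞ (fun y ↦ JForm J θ y (X y)) := by
  simp only [← hlck.hermitian.fundForm_sharp_left]
  exact (hlck.hermitian.complex.smooth.apply hT).inner hX

/-- `d(J θ) = 2 ω(F ·, ·) - |θ|² ω + θ ∧ J θ` for a holomorphic Lee field. -/
theorem IsLCK.dOne_JForm_lee (hlck : IsLCK J θ) (hhol : IsHolomorphicVF J (sharp θ))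
    (hX : IsSmoothVF X) (hY : IsSmoothVF Y) (x : M) :
    dOne (JForm J θ) X Y x = 2 * fundForm J x (leviCivita (sharp θ) x (X x)) (Y x)
      - normSq θ x * fundForm J x (X x) (Y x)
      + (θ x (X x) * JForm J θ x (Y x) - θ x (Y x) * JForm J θ x (X x)) := by
  -- Cartan's formula for `ω` by hand: `dω(T, X, Y)` contains `L_T ω` and `d(Jθ)`, once antisymmetry
  -- of `ω` brings `T` to the first slot.
  have hd := hlck.d_fundForm _ _ _ hhol.1 hX hY x
  have hl := hlck.lieDeriv_fundForm hhol hX hY x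
  have hH := hlck.hermitian
  have e : (fun y ↦ fundForm J y (Y y) (sharp θ y)) = fun y ↦ -JForm J θ y (Y y) :=
    funext fun y ↦ by rw [hH.fundForm_swap, hH.fundForm_sharp_left]
  simp only [dTwo, wedgeOneTwo] at hd
  rw [e, dirDeriv_neg, mlieBracket_swap_apply (V := Y) (W := sharp θ),
    hH.fundForm_swap x (mlieBracket 𝓘(ℝ, E) X Y x), hH.fundForm_swap x (Y x) (sharp θ x),
    hH.fundForm_swap x (-_) (X x)] at hd
  simp only [hH.fundForm_sharp_left, ← normSq_eq_apply_sharp] at hd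
  have e' : fundForm J x (X x) (-mlieBracket 𝓘(ℝ, E) (sharp θ) Y x) =
      -fundForm J x (X x) (mlieBracket 𝓘(ℝ, E) (sharp θ) Y x) := by
    simp only [fundForm, inner_neg_right]
  rw [e'] at hd
  rw [dOne]
  linarith

end Lee

end LCK

/-! ### The formula for `dJd|θ|²`. -/

theorem proposition4
    {E : Type*} [NormedAddCommGroup E] [NormedSpace ℝ E] [FiniteDimensional ℝ E]
    {M : Type*} [TopologicalSpace M] [T2Space M] [ChartedSpace E M] [IsManifold 𝓘(ℝ, E) ∞ M]
    [RiemannianBundle (fun x : M ↦ TangentSpace 𝓘(ℝ, E) x)]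
    [IsContMDiffRiemannianBundle 𝓘(ℝ, E) ∞ E (fun x : M ↦ TangentSpace 𝓘(ℝ, E) x)]
    (J : Π x : M, TangentSpace 𝓘(ℝ, E) x →L[ℝ] TangentSpace 𝓘(ℝ, E) x)
    (θ : Π x : M, TangentSpace 𝓘(ℝ, E) x →L[ℝ] ℝ)
    (hlck : LCK.IsLCK J θ)
    (T : Π x : M, TangentSpace 𝓘(ℝ, E) x) (hT : T = LCK.sharp θ)
    (hhol : LCK.IsHolomorphicVF J T)
    (F : Π x : M, TangentSpace 𝓘(ℝ, E) x →L[ℝ] TangentSpace 𝓘(ℝ, E) x)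
    (hF : F = LCK.leviCivita T)
    (X Y : Π x : M, TangentSpace 𝓘(ℝ, E) x) (hX : LCK.IsSmoothVF X) (hY : LCK.IsSmoothVF Y)
    (x : M) :
    LCK.dOne (LCK.JForm J (LCK.dZero (LCK.normSq θ))) X Y x =
      4 * LCK.fundForm J x (F x (F x (X x))) (Y x)
        + 2 * LCK.fundForm J x (LCK.lieDerivEnd T F X x) (Y x)
        - LCK.dirDeriv T (LCK.normSq θ) x * LCK.fundForm J x (X x) (Y x)
        - 2 * LCK.normSq θ x * LCK.fundForm J x (F x (X x)) (Y x)
        + LCK.wedgeOneOne (LCK.dZero (LCK.normSq θ)) (LCK.JForm J θ) x (X x) (Y x)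
        + LCK.wedgeOneOne θ (LCK.JForm J (LCK.dZero (LCK.normSq θ))) x (X x) (Y x) := by
  subst hT
  have : CompleteSpace E := FiniteDimensional.complete ℝ E
  have hTs := hhol.1
  have hJ := hlck.hermitian.complex.smooth
  have hFX : LCK.IsSmoothVF (fun y ↦ F y (X y)) := hF ▸ hX.leviCivita hTs
  have hmd : ∀ {h : M → ℝ}, ContMDiff 𝓘(ℝ, E) 𝓘(ℝ) ∞ h → MDifferentiableAt 𝓘(ℝ, E) 𝓘(ℝ) h x :=
    fun hh ↦ (hh x).mdifferentiableAt (by simp)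
  have sθ : ∀ {Z : Π x : M, TangentSpace 𝓘(ℝ, E) x}, LCK.IsSmoothVF Z →
      ContMDiff 𝓘(ℝ, E) 𝓘(ℝ) ∞ (fun y ↦ θ y (Z y)) := by
    intro Z hZ
    simp only [← LCK.inner_sharp_left]
    exact hTs.inner hZ
  have sf : MDifferentiableAt 𝓘(ℝ, E) 𝓘(ℝ) (LCK.normSq θ) x := by
    rw [show LCK.normSq θ = fun y ↦ θ y (LCK.sharp θ y) from
      funext (LCK.normSq_eq_apply_sharp θ)]
    exact hmd (sθ hTs)
  have sω : MDifferentiableAt 𝓘(ℝ, E) 𝓘(ℝ) (fun y ↦ LCK.fundForm J y (X y) (Y y)) x :=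
    hmd ((hJ.apply hX).inner hY)
  have sωF : MDifferentiableAt 𝓘(ℝ, E) 𝓘(ℝ) (fun y ↦ LCK.fundForm J y (F y (X y)) (Y y)) x :=
    hmd ((hJ.apply hFX).inner hY)
  have sθX := hmd (sθ hX)
  have sθY := hmd (sθ hY)
  have sJX := hmd (hlck.contMDiff_JForm hTs hX)
  have sJY := hmd (hlck.contMDiff_JForm hTs hY)
  have s2ωF : MDifferentiableAt 𝓘(ℝ, E) 𝓘(ℝ)
      (fun y ↦ 2 * LCK.fundForm J y (F y (X y)) (Y y)) x := mdifferentiableAt_const.mul sωF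
  have sfω : MDifferentiableAt 𝓘(ℝ, E) 𝓘(ℝ)
      (fun y ↦ LCK.normSq θ y * LCK.fundForm J y (X y) (Y y)) x := sf.mul sω
  have sXY : MDifferentiableAt 𝓘(ℝ, E) 𝓘(ℝ)
      (fun y ↦ θ y (X y) * LCK.JForm J θ y (Y y)) x := sθX.mul sJY
  have sYX : MDifferentiableAt 𝓘(ℝ, E) 𝓘(ℝ)
      (fun y ↦ θ y (Y y) * LCK.JForm J θ y (X y)) x := sθY.mul sJX
  have sA : MDifferentiableAt 𝓘(ℝ, E) 𝓘(ℝ) (fun y ↦ 2 * LCK.fundForm J y (F y (X y)) (Y y)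
      - LCK.normSq θ y * LCK.fundForm J y (X y) (Y y)) x := s2ωF.sub sfω
  have sB : MDifferentiableAt 𝓘(ℝ, E) 𝓘(ℝ) (fun y ↦ θ y (X y) * LCK.JForm J θ y (Y y)
      - θ y (Y y) * LCK.JForm J θ y (X y)) x := sXY.sub sYX
  -- General arguments are needed: `L_T(d(Jθ))` also evaluates `d(Jθ)` on `[T, X]` and `[T, Y]`.
  have key : ∀ {P Q : Π x : M, TangentSpace 𝓘(ℝ, E) x}, LCK.IsSmoothVF P → LCK.IsSmoothVF Q →
      ∀ y, LCK.dOne (LCK.JForm J θ) P Q y = 2 * LCK.fundForm J y (F y (P y)) (Q y)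
        - LCK.normSq θ y * LCK.fundForm J y (P y) (Q y)
        + (θ y (P y) * LCK.JForm J θ y (Q y) - θ y (Q y) * LCK.JForm J θ y (P y)) := by
    intro P Q hP hQ y
    rw [hF]
    exact hlck.dOne_JForm_lee hhol hP hQ y
  have hω := hlck.lieDeriv_fundForm hhol hX hY x
  -- With `FX` in the first slot, the right side becomes `2ω(F²X, Y)`.
  have hωF := hlck.lieDeriv_fundForm hhol hFX hY x
  rw [← hF] at hω hωF
  rw [LCK.dOne_lieDeriv (fun Z hZ ↦ hlck.contMDiff_JForm hTs hZ) hTs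
      (fun Z hZ ↦ hlck.lieDeriv_JForm_lee hhol hZ) hX hY,
    key (hTs.mlieBracket hX) hY, key hX (hTs.mlieBracket hY), funext (key hX hY),
    LCK.dirDeriv_add _ sA sB, LCK.dirDeriv_sub _ s2ωF sfω,
    LCK.dirDeriv_sub _ sXY sYX,
    LCK.dirDeriv_const_mul _ _ sωF, LCK.dirDeriv_mul _ sf sω,
    LCK.dirDeriv_mul _ sθX sJY, LCK.dirDeriv_mul _ sθY sJX]
  -- Unfolding `Jd|θ|²` as `L_T(Jθ)` and `d|θ|²` as `L_T θ` makes the wedge terms the product rule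
  -- for `L_T(θ ∧ Jθ)`.
  simp only [LCK.wedgeOneOne, hlck.lieDeriv_JForm_lee hhol hX, hlck.lieDeriv_JForm_lee hhol hY,
    ← hlck.lieDeriv_lee hTs hX, ← hlck.lieDeriv_lee hTs hY]
  have hL : LCK.fundForm J x (LCK.lieDerivEnd (LCK.sharp θ) F X x) (Y x) =
      LCK.fundForm J x (mlieBracket 𝓘(ℝ, E) (LCK.sharp θ) (fun y ↦ F y (X y)) x) (Y x)
        - LCK.fundForm J x (F x (mlieBracket 𝓘(ℝ, E) (LCK.sharp θ) X x)) (Y x) := by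
    simp only [LCK.fundForm, LCK.lieDerivEnd, map_sub, inner_sub_left]
  rw [hL]
  -- The weights are the coefficients of `ω(F·,·)` and `ω` in `d(Jθ)`.
  linear_combination 2 * hωF - LCK.normSq θ x * hω
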